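/- Let $\alpha:\mathbb N\to\mathbb N$. For $w>0$ (and $n,\alpha(n)\ge1$) let $x_{n,\alpha}(w)$ be the unique positive solution of $$\sum_{j=1}^{\alpha(n)} x_{n,\alpha}(w)^j=\frac nw,$$ let $x'_{n,\alpha}$ be its derivative with respect to $w$, and put $$m_{n,\alpha}:=\sum_{j=1}^{\alpha(n)}\frac{x_{n,\alpha}(1)^j}{j},\qquad v_{n,\alpha}:=m_{n,\alpha}+n\,\frac{x'_{n,\alpha}(1)}{x_{n,\alpha}(1)}.$$ (These are the asymptotic mean and variance of the number of cycles of a uniform random permutation of $n$ elements without cycles longer than $\alpha(n)$.) For $u>0$, $u\ne1$, let $\xi(u)$ be the nonzero solution of $e^{\xi}=1+u\xi$, and let $\xi(1)=0$. For functions $\phi_k$ with $\phi_{k+1}(n)=o(\phi_k(n))$ as $n\to\infty$ for all $k\ge k_0$, write $f(n)\sim\sum_{k\ge k_0}a_k\phi_k(n)$ if $f(n)=\sum_{k=k_0}^{N}a_k\phi_k(n)+o(\phi_N(n))$ as $n\to\infty$ for every $N\ge k_0$. Theorem 2 (quantitative). Suppose that there are $\alpha_0,\alpha_1\in(0,1)$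 with $\lim_{n\to\infty}n^{-\alpha_0}\alpha(n)=\infty$ and $\lim_{n\to\infty}n^{-\alpha_1}\alpha(n)=0$. Then, as $n\to\infty$, with respect to the functions $\phi_k(n)=\frac{n}{\alpha(n)}\,\xi\!\left(\frac n{\alpha(n)}\right)^{-k}$, there are the asymptotic expansions $$m_{n,\alpha}\sim\frac{n}{\alpha(n)}\sum_{k=0}^\infty\frac{k!}{\xi\left(\frac n{\alpha(n)}\right)^k}\qquad\text{and}\qquad v_{n,\alpha}\sim\frac{n}{\alpha(n)}\sum_{k=2}^\infty\frac{k!-1}{\xi\left(\frac n{\alpha(n)}\right)^k}.$$ In particular $v_{n,\alpha}=o(m_{n,\alpha})$, so that $m_{n,\alpha}$ and $v_{n,\alpha}$ are of different orders. -/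

import Mathlib

open Filter Topology Asymptotics

namespace CycleRestricted

noncomputable section

/-- `∑_{k ≥ k₀} a k * φ k` is an asymptotic expansion of `f` along the filter `l`: the functions
`φ k` form an asymptotic scale, and for every `N ≥ k₀` the partial sum up to `N` approximates `f`
up to `o(φ N)`. -/
def IsAsymptoticExpansion {ι : Type*} (l : Filter ι) (f : ι → ℝ) (k₀ : ℕ) (a : ℕ → ℝ)
    (φ : ℕ → ι → ℝ) : Prop :=
  (∀ k, k₀ ≤ k → φ (k + 1) =o[l] φ k) ∧
    ∀ N, k₀ ≤ N → (fun z => f z - ∑ k ∈ Finset.Icc k₀ N, a k * φ k z) =o[l] φ N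

/-- The function `x_{n,α}` of `w`: the unique positive solution `x` of
`∑_{j=1}^{α(n)} x^j = n / w` (it exists and is unique for `n, α(n) ≥ 1` and `w > 0`, see
`saddle_existsUnique`; the infimum is over that singleton). -/
def saddle (α : ℕ → ℕ) (n : ℕ) (w : ℝ) : ℝ :=
  sInf {x : ℝ | 0 < x ∧ ∑ j ∈ Finset.Icc 1 (α n), x ^ j = (n : ℝ) / w}

/-- `m_{n,α} = ∑_{j=1}^{α(n)} x_{n,α}(1)^j / j`. -/
def mean (α : ℕ → ℕ) (n : ℕ) : ℝ :=
  ∑ j ∈ Finset.Icc 1 (α n), saddle α n 1 ^ j / (j : ℝ)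

/-- `v_{n,α} = m_{n,α} + n x'_{n,α}(1) / x_{n,α}(1)`, where the derivative is with respect to `w`
(it exists, see `saddle_differentiableAt`). -/
def var (α : ℕ → ℕ) (n : ℕ) : ℝ :=
  mean α n + (n : ℝ) * (deriv (fun w : ℝ => saddle α n w) 1 / saddle α n 1)

/-- `ξ(u)` is the nonzero solution of `exp ξ = 1 + u ξ` (existing and unique for `u > 0`, `u ≠ 1`,
see `xi_existsUnique`; the infimum is over that singleton), and `ξ(1) = 0`. -/
def xi (u : ℝ) : ℝ :=
  if u = 1 then 0 else sInf {t : ℝ | t ≠ 0 ∧ Real.exp t = 1 + u * t}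

/-! The defining equations have the unique solutions claimed above, and `x_{n,α}` is
differentiable. -/

theorem sum_pow_lt {a : ℕ} (ha : 1 ≤ a) {x y : ℝ} (hx : 0 < x) (hxy : x < y) :
    ∑ j ∈ Finset.Icc 1 a, x ^ j < ∑ j ∈ Finset.Icc 1 a, y ^ j := by
  refine Finset.sum_lt_sum_of_nonempty ⟨1, by simp [ha]⟩ fun j hj => ?_
  have := (Finset.mem_Icc.1 hj).1
  exact pow_lt_pow_left₀ hxy hx.le (by omega)

theorem sum_pow_existsUnique {a : ℕ} (ha : 1 ≤ a) {c : ℝ} (hc : 0 < c) :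
    ∃! x : ℝ, 0 < x ∧ ∑ j ∈ Finset.Icc 1 a, x ^ j = c := by
  have h0 : ∑ j ∈ Finset.Icc 1 a, (0 : ℝ) ^ j = 0 := by
    refine Finset.sum_eq_zero fun j hj => ?_
    have := (Finset.mem_Icc.1 hj).1
    exact zero_pow (by omega)
  have h1 : c ≤ ∑ j ∈ Finset.Icc 1 a, c ^ j := by
    have := Finset.single_le_sum (f := fun j => c ^ j) (s := Finset.Icc 1 a)
      (fun j _ => by positivity) (Finset.mem_Icc.2 ⟨le_refl 1, ha⟩)
    simpa using this
  obtain ⟨x, hx, hxc⟩ := intermediate_value_Icc (f := fun x : ℝ => ∑ j ∈ Finset.Icc 1 a, x ^ j)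
    hc.le (by fun_prop) (show c ∈ Set.Icc _ _ from ⟨by simpa only [h0] using hc.le, h1⟩)
  have hxc' : ∑ j ∈ Finset.Icc 1 a, x ^ j = c := hxc
  have hx0 : 0 < x := by
    rcases hx.1.eq_or_lt with h | h
    · rw [← h, h0] at hxc'
      exact absurd hxc' hc.ne
    · exact h
  refine ⟨x, ⟨hx0, hxc'⟩, fun y hy => ?_⟩
  rcases lt_trichotomy y x with h | h | h
  · have := sum_pow_lt ha hy.1 h
    linarith [hy.2]
  · exact h
  · have := sum_pow_lt ha hx0 h
    linarith [hy.2]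

theorem saddle_existsUnique {α : ℕ → ℕ} {n : ℕ} (hn : 1 ≤ n) (ha : 1 ≤ α n) {w : ℝ}
    (hw : 0 < w) : ∃! x : ℝ, 0 < x ∧ ∑ j ∈ Finset.Icc 1 (α n), x ^ j = (n : ℝ) / w :=
  sum_pow_existsUnique ha (div_pos (by exact_mod_cast hn) hw)

theorem saddle_eq_of {α : ℕ → ℕ} {n : ℕ} (hn : 1 ≤ n) (ha : 1 ≤ α n) {w : ℝ} (hw : 0 < w) {x : ℝ}
    (hx : 0 < x) (hs : ∑ j ∈ Finset.Icc 1 (α n), x ^ j = (n : ℝ) / w) : saddle α n w = x := by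
  have : {x : ℝ | 0 < x ∧ ∑ j ∈ Finset.Icc 1 (α n), x ^ j = (n : ℝ) / w} = {x} := by
    ext y
    exact ⟨fun hy => (saddle_existsUnique hn ha hw).unique hy ⟨hx, hs⟩,
      fun hy => by rw [Set.mem_singleton_iff.1 hy]; exact ⟨hx, hs⟩⟩
  rw [saddle, this, csInf_singleton]

theorem saddle_spec {α : ℕ → ℕ} {n : ℕ} (hn : 1 ≤ n) (ha : 1 ≤ α n) {w : ℝ} (hw : 0 < w) :
    0 < saddle α n w ∧ ∑ j ∈ Finset.Icc 1 (α n), saddle α n w ^ j = (n : ℝ) / w := by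
  obtain ⟨x, hx, -⟩ := saddle_existsUnique hn ha hw
  rwa [saddle_eq_of hn ha hw hx.1 hx.2]

theorem saddle_differentiableAt {α : ℕ → ℕ} {n : ℕ} (hn : 1 ≤ n) (ha : 1 ≤ α n) {w : ℝ}
    (hw : 0 < w) : DifferentiableAt ℝ (fun w : ℝ => saddle α n w) w := by
  obtain ⟨hx, hs⟩ := saddle_spec hn ha hw
  set x := saddle α n w with hxdef
  let S : ℝ → ℝ := fun t => ∑ j ∈ Finset.Icc 1 (α n), t ^ j
  have hS : HasStrictDerivAt S (∑ j ∈ Finset.Icc 1 (α n), (j : ℝ) * x ^ (j - 1)) x :=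
    HasStrictDerivAt.fun_sum fun j _ => hasStrictDerivAt_pow j x
  have hne : (∑ j ∈ Finset.Icc 1 (α n), (j : ℝ) * x ^ (j - 1)) ≠ 0 := by
    refine (Finset.sum_pos (fun j hj => ?_) ⟨1, by simp [ha]⟩).ne'
    have : 0 < j := (Finset.mem_Icc.1 hj).1
    positivity
  have hright := (hS.hasStrictFDerivAt_equiv hne).eventually_right_inverse
  have hg := (hS.to_localInverse hne)
  have hgx : hS.localInverse S _ x hne (S x) = x :=
    (hS.hasStrictFDerivAt_equiv hne).localInverse_apply_image
  set g := hS.localInverse S _ x hne with hgdef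
  have hSx : S x = (n : ℝ) / w := hs
  have hdiv : DifferentiableAt ℝ (fun t : ℝ => (n : ℝ) / t) w :=
    (differentiableAt_const _).div differentiableAt_id hw.ne'
  have hpos : ∀ᶠ y in 𝓝 (S x), 0 < g y :=
    hg.hasDerivAt.continuousAt.eventually (by rw [hgx]; exact lt_mem_nhds hx)
  have htend : Tendsto (fun t : ℝ => (n : ℝ) / t) (𝓝 w) (𝓝 (S x)) := by
    rw [hSx]; exact hdiv.continuousAt
  have heq : (fun t : ℝ => saddle α n t) =ᶠ[𝓝 w] fun t => g ((n : ℝ) / t) := by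
    filter_upwards [htend.eventually hpos, htend.eventually hright, lt_mem_nhds hw]
      with t h1 h2 h3
    exact saddle_eq_of hn ha h3 h1 h2
  refine DifferentiableAt.congr_of_eventuallyEq ?_ heq
  have hgd : DifferentiableAt ℝ g ((n : ℝ) / w) := hSx ▸ hg.hasDerivAt.differentiableAt
  exact hgd.comp w hdiv

theorem xi_existsUnique {u : ℝ} (hu : 0 < u) (hu1 : u ≠ 1) :
    ∃! t : ℝ, t ≠ 0 ∧ Real.exp t = 1 + u * t := by
  let f : ℝ → ℝ := fun t => Real.exp t - (1 + u * t)
  have hf : Continuous f := by fun_prop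
  have hlow : f (Real.log u) < 0 := by
    have h := Real.log_lt_sub_one_of_pos (inv_pos.2 hu) (by simpa using hu1)
    rw [Real.log_inv] at h
    have h2 := mul_lt_mul_of_pos_left h hu
    have h3 : u * (u⁻¹ - 1) = 1 - u := by field_simp
    simp only [f, Real.exp_log hu]
    linarith
  have hex : ∃ t : ℝ, t ≠ 0 ∧ Real.exp t = 1 + u * t := by
    rcases lt_or_gt_of_ne hu1 with h | h
    · have hlog : Real.log u < 0 := Real.log_neg hu h
      have hle : -u⁻¹ ≤ Real.log u := by
        have := Real.one_sub_inv_le_log_of_pos hu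
        linarith
      have hhi : 0 < f (-u⁻¹) := by
        have : u * -u⁻¹ = -1 := by field_simp
        simp only [f, this]
        have := Real.exp_pos (-u⁻¹)
        linarith
      obtain ⟨t, ht, h0⟩ := intermediate_value_Icc' hle hf.continuousOn ⟨hlow.le, hhi.le⟩
      exact ⟨t, (ht.2.trans_lt hlog).ne, sub_eq_zero.1 h0⟩
    · have hlog : 0 < Real.log u := Real.log_pos h
      have hle : Real.log u ≤ 2 * u := by
        have := Real.log_le_sub_one_of_pos hu
        linarith
      have hhi : 0 < f (2 * u) := by
        have := Real.quadratic_le_exp_of_nonneg (show 0 ≤ 2 * u by linarith)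
        simp only [f]
        nlinarith
      obtain ⟨t, ht, h0⟩ := intermediate_value_Icc hle hf.continuousOn ⟨hlow.le, hhi.le⟩
      exact ⟨t, (hlog.trans_le ht.1).ne', sub_eq_zero.1 h0⟩
  have key : ∀ s t : ℝ, s ≠ 0 → Real.exp s = 1 + u * s → t ≠ 0 → Real.exp t = 1 + u * t →
      ¬ s < t := by
    intro s t hs0 hs ht0 ht hst
    have := strictConvexOn_exp.secant_strict_mono (Set.mem_univ 0) (Set.mem_univ s)
      (Set.mem_univ t) hs0 ht0 hst
    simp only [hs, ht, Real.exp_zero, add_sub_cancel_left, sub_zero] at this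
    rw [mul_div_cancel_right₀ _ hs0, mul_div_cancel_right₀ _ ht0] at this
    exact lt_irrefl _ this
  obtain ⟨t, ht0, ht⟩ := hex
  exact ⟨t, ⟨ht0, ht⟩, fun s hs => le_antisymm (not_lt.1 (key t s ht0 ht hs.1 hs.2))
    (not_lt.1 (key s t hs.1 hs.2 ht0 ht))⟩

theorem xi_spec {u : ℝ} (hu : 0 < u) (hu1 : u ≠ 1) :
    xi u ≠ 0 ∧ Real.exp (xi u) = 1 + u * xi u := by
  obtain ⟨t, ht, huniq⟩ := xi_existsUnique hu hu1
  have : {t : ℝ | t ≠ 0 ∧ Real.exp t = 1 + u * t} = {t} := by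
    ext y
    exact ⟨fun hy => huniq y hy, fun hy => by rw [Set.mem_singleton_iff.1 hy]; exact ht⟩
  rwa [xi, if_neg hu1, this, csInf_singleton]

end

end CycleRestricted

/-! Write `a = α(n)`, `u = n/a`, `x = x_{n,α}(1)`, `σ = a(1 - 1/x)`, `p = 1/σ`, `ξ = ξ(u)`. The
geometric sum turns the saddle point equation into `x^a = 1 + uσ`. Since `x^a = exp(a log x)` and `a
log x` is close to `σ`, this is nearly the equation `exp ξ = 1 + uξ`, and `p` differs from `1/ξ` by
at most `4ξ²/a` (`abs_inv_scaled_sub_le`). The lower growth bound makes `1/a` smaller than every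
power of `1/ξ`; the upper one makes `u` and `ξ` tend to infinity, and `1/u ≤ 2ξ exp(-ξ)` is then
just as small. Errors of this kind are invisible in the expansions, and `SuperpolyEq` is the
calculus that discards them.

For the mean, the terms with `j ≤ a/2` are negligible: relative to `u` they have size about
`exp(-ξ/2)` up to powers of `ξ`, because `log a = O(ξ)`. On `a/2 < j ≤ a`, repeated summation by
parts against reciprocal rising factorials (`sum_pow_div_eq`) produces `u · k! p^k` up to negligible
factors, with a remainder of order `u p^K`.

For the variance, implicit differentiation gives `m - v = n² / ∑ j x^j` (`var_eq`), and `∑ j x^j`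
has a closed form, so `(m - v)/u = 1/(1 - p + 1/a + p/u)`. This is the geometric series in `1/ξ` up
to negligible terms. Subtracting it from `∑ k! ξ^{-k}` leaves the coefficients `k! - 1`, which
vanish for `k = 0, 1`; hence `m/u → 1` while `v/u → 0`. -/

namespace CycleRestricted

/-! ### Summation by parts -/

/-- Reciprocal rising factorials replace the powers `1/j^(k+1)` because their differences are
exactly one term of the next order, so iteration creates no correction terms. -/
theorem inv_ascFactorial_sub {j : ℕ} (hj : 0 < j) (k : ℕ) :
    ((j.ascFactorial (k + 1) : ℕ) : ℝ)⁻¹ - (((j + 1).ascFactorial (k + 1) : ℕ) : ℝ)⁻¹ =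
      (k + 1) * ((j.ascFactorial (k + 2) : ℕ) : ℝ)⁻¹ := by
  have h1 : (j : ℝ) * ((j + 1).ascFactorial (k + 1) : ℕ) =
      (j + (k + 1)) * (j.ascFactorial (k + 1) : ℕ) := by
    exact_mod_cast Nat.succ_ascFactorial j (k + 1)
  have h2 : ((j.ascFactorial (k + 2) : ℕ) : ℝ) = (j + (k + 1)) * (j.ascFactorial (k + 1) : ℕ) := by
    exact_mod_cast Nat.ascFactorial_succ (n := j) (k := k + 1)
  have hA : (0 : ℝ) < (j.ascFactorial (k + 1) : ℕ) := by
    obtain ⟨i, rfl⟩ := Nat.exists_eq_succ_of_ne_zero hj.ne'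
    exact_mod_cast Nat.ascFactorial_pos i (k + 1)
  have hB : (0 : ℝ) < ((j + 1).ascFactorial (k + 1) : ℕ) := by
    exact_mod_cast Nat.ascFactorial_pos j (k + 1)
  have hj' : (0 : ℝ) < j := by exact_mod_cast hj
  rw [h2]
  field_simp
  linear_combination h1

theorem sum_pow_mul_inv_ascFactorial {x : ℝ} (hx : x ≠ 1) {J a : ℕ} (hJ : J ≤ a) (k : ℕ) :
    ∑ j ∈ Finset.Ioc J a, x ^ j * ((j.ascFactorial (k + 1) : ℕ) : ℝ)⁻¹ =
      x / (x - 1) * (x ^ a * (((a + 1).ascFactorial (k + 1) : ℕ) : ℝ)⁻¹ -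
        x ^ J * (((J + 1).ascFactorial (k + 1) : ℕ) : ℝ)⁻¹ +
        (k + 1) * ∑ j ∈ Finset.Ioc J a, x ^ j * ((j.ascFactorial (k + 2) : ℕ) : ℝ)⁻¹) := by
  have hx' : x - 1 ≠ 0 := sub_ne_zero.2 hx
  induction a, hJ using Nat.le_induction with
  | base => simp
  | succ a ha ih =>
    rw [← Finset.insert_Ioc_right_eq_Ioc_add_one ha, Finset.sum_insert (by simp),
      Finset.sum_insert (by simp), ih]
    have := inv_ascFactorial_sub (Nat.succ_pos a) k
    have hq : x / (x - 1) * (x - 1) = x := div_mul_cancel₀ _ hx'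
    rw [Nat.succ_eq_add_one] at this
    linear_combination x / (x - 1) * x ^ (a + 1) * this -
      x ^ a * (((a + 1).ascFactorial (k + 1) : ℕ) : ℝ)⁻¹ * hq

/-- Discrete form of integrating `x^t / t` by parts `K` times: each step contributes boundary terms
at `a` and `J`, and the factors `k + 1` accumulate to the factorials of the expansion. -/
theorem sum_pow_div_eq {x : ℝ} (hx : x ≠ 1) {J a : ℕ} (hJ : J ≤ a) (K : ℕ) :
    ∑ j ∈ Finset.Ioc J a, x ^ j / (j : ℝ) =
      ∑ k ∈ Finset.range K, (k.factorial : ℝ) * (x / (x - 1)) ^ (k + 1) *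
        (x ^ a * (((a + 1).ascFactorial (k + 1) : ℕ) : ℝ)⁻¹ -
          x ^ J * (((J + 1).ascFactorial (k + 1) : ℕ) : ℝ)⁻¹) +
      (K.factorial : ℝ) * (x / (x - 1)) ^ K *
        ∑ j ∈ Finset.Ioc J a, x ^ j * ((j.ascFactorial (K + 1) : ℕ) : ℝ)⁻¹ := by
  induction K with
  | zero => simp [Nat.ascFactorial_succ, div_eq_mul_inv]
  | succ K ih =>
    rw [ih, Finset.sum_range_succ, sum_pow_mul_inv_ascFactorial hx hJ K, Nat.factorial_succ]
    push_cast
    ring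

theorem sum_pow_mul_sub_one (x : ℝ) (a : ℕ) :
    (∑ j ∈ Finset.Icc 1 a, x ^ j) * (x - 1) = x * (x ^ a - 1) := by
  induction a with
  | zero => simp
  | succ a ih =>
    rw [Finset.sum_Icc_succ_top (by omega), add_mul, ih]
    ring

theorem sum_mul_pow_mul_sub_one (x : ℝ) (a : ℕ) :
    (∑ j ∈ Finset.Icc 1 a, (j : ℝ) * x ^ j) * (x - 1) =
      a * x ^ (a + 1) - ∑ j ∈ Finset.Icc 1 a, x ^ j := by
  induction a with
  | zero => simp
  | succ a ih =>
    rw [Finset.sum_Icc_succ_top (by omega), Finset.sum_Icc_succ_top (by omega), add_mul, ih]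
    push_cast
    ring

/-! ### The saddle point in the scale of `ξ` -/

section Pointwise

variable {a n : ℕ} {x : ℝ}

theorem one_lt_of_sum_pow_eq (hx : 0 < x) (hs : ∑ j ∈ Finset.Icc 1 a, x ^ j = n) (han : a < n) :
    1 < x := by
  by_contra! h
  have : ∑ j ∈ Finset.Icc 1 a, x ^ j ≤ ∑ j ∈ Finset.Icc 1 a, (1 : ℝ) :=
    Finset.sum_le_sum fun j _ => pow_le_one₀ hx.le h
  rw [hs] at this
  simp only [Finset.sum_const, Nat.card_Icc, add_tsub_cancel_right, nsmul_eq_mul, mul_one] at this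
  exact absurd han (not_lt.2 (by exact_mod_cast this))

theorem pow_eq_one_add (hx : 1 < x) (ha : 0 < a) (hs : ∑ j ∈ Finset.Icc 1 a, x ^ j = n) :
    x ^ a = 1 + (n / a : ℝ) * (a * (1 - 1 / x)) := by
  have h := sum_pow_mul_sub_one x a
  rw [hs] at h
  have ha' : (0 : ℝ) < a := by exact_mod_cast ha
  field_simp
  linear_combination -h

theorem le_mul_pow (hx : 1 < x) (hs : ∑ j ∈ Finset.Icc 1 a, x ^ j = n) : (n : ℝ) ≤ a * x ^ a := by
  have : ∑ j ∈ Finset.Icc 1 a, x ^ j ≤ ∑ j ∈ Finset.Icc 1 a, x ^ a :=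
    Finset.sum_le_sum fun j hj => pow_le_pow_right₀ hx.le (Finset.mem_Icc.1 hj).2
  rw [hs] at this
  simpa using this

theorem sum_mul_pow_eq (hx : 1 < x) (ha : 0 < a) (hn : 0 < n)
    (hs : ∑ j ∈ Finset.Icc 1 a, x ^ j = n) :
    ∑ j ∈ Finset.Icc 1 a, (j : ℝ) * x ^ j =
      n * a * (1 - 1 / (a * (1 - 1 / x)) + 1 / a + 1 / (a * (1 - 1 / x)) / (n / a)) := by
  have h := sum_pow_mul_sub_one x a
  have h2 := sum_mul_pow_mul_sub_one x a
  rw [hs] at h h2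
  have ha' : (0 : ℝ) < a := by exact_mod_cast ha
  have hn' : (0 : ℝ) < n := by exact_mod_cast hn
  have hx1 : x - 1 ≠ 0 := by linarith
  refine mul_right_cancel₀ hx1 (h2.trans ?_)
  have hx2 : 1 - 1 / x = (x - 1) / x := by field_simp
  rw [hx2]
  field_simp
  linear_combination (-(a : ℝ)) * h

theorem xi_pos {u : ℝ} (hu : 1 < u) : 0 < xi u := by
  obtain ⟨h0, h⟩ := xi_spec (by linarith) hu.ne'
  by_contra! hle
  have hneg := lt_of_le_of_ne hle h0
  have := Real.add_one_lt_exp h0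
  nlinarith

/-- By strict convexity the secant slope `(exp t - 1)/t` increases strictly, and it equals `u`
exactly at `ξ(u)`. -/
theorem le_xi_of_exp_le {u t : ℝ} (hu : 1 < u) (ht : 0 < t) (h : Real.exp t ≤ 1 + u * t) :
    t ≤ xi u := by
  obtain ⟨h0, hxi⟩ := xi_spec (by linarith) hu.ne'
  by_contra! hlt
  have := strictConvexOn_exp.secant_strict_mono (Set.mem_univ 0) (Set.mem_univ (xi u))
    (Set.mem_univ t) h0 ht.ne' hlt
  simp only [hxi, Real.exp_zero, add_sub_cancel_left, sub_zero] at this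
  rw [mul_div_cancel_right₀ _ h0, lt_div_iff₀ ht] at this
  linarith

/-- A crude lower bound, needed for the factor `1/2` in `abs_inv_scaled_sub_le`. From `x^a ≥ n/a ≥
exp 4` follows `a(x - 1) ≥ 4`, whereas `σ < 2` would give `a(x - 1) < 2x`; these are incompatible
for `a ≥ 4`. -/
theorem two_le_scaled (hx : 1 < x) (ha : 4 ≤ a) (hs : ∑ j ∈ Finset.Icc 1 a, x ^ j = n)
    (hu : Real.exp 4 ≤ n / a) : 2 ≤ a * (1 - 1 / x) := by
  have ha' : (4 : ℝ) ≤ a := by exact_mod_cast ha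
  by_contra! hlt
  have hx0 : 0 < x := by linarith
  have hle : Real.exp 4 ≤ x ^ a := by
    refine hu.trans ?_
    rw [div_le_iff₀ (by linarith)]
    linarith [le_mul_pow hx hs]
  have h4 : 4 ≤ a * Real.log x := by
    rw [← Real.log_pow, Real.le_log_iff_exp_le (by positivity)]
    exact hle
  have hlog := Real.log_le_sub_one_of_pos hx0
  have hx2 : a * (x - 1) = a * (1 - 1 / x) * x := by field_simp
  have h5 : (a : ℝ) * (x - 1) < 2 * x := by
    rw [hx2]; exact mul_lt_mul_of_pos_right hlt hx0
  nlinarith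

/-- Since `1 - 1/x ≤ log x`, one has `exp σ ≤ x^a = 1 + uσ`, and the secant criterion applies. -/
theorem scaled_le_xi (hx : 1 < x) (ha : 0 < a) (hs : ∑ j ∈ Finset.Icc 1 a, x ^ j = n)
    (hu : (1 : ℝ) < n / a) : a * (1 - 1 / x) ≤ xi (n / a) := by
  have ha' : (0 : ℝ) < a := by exact_mod_cast ha
  have hx0 : 0 < x := by linarith
  have hpos : 0 < 1 - 1 / x := by
    rw [sub_pos, div_lt_one hx0]; exact hx
  refine le_xi_of_exp_le hu (by positivity) ?_
  rw [← pow_eq_one_add hx ha hs, ← Real.le_log_iff_exp_le (by positivity), Real.log_pow]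
  have := Real.one_sub_inv_le_log_of_pos hx0
  rw [one_div]
  gcongr

theorem abs_inv_scaled_sub_le (hx : 1 < x) (ha : 4 ≤ a) (hs : ∑ j ∈ Finset.Icc 1 a, x ^ j = n)
    (hu : Real.exp 4 ≤ n / a) (hxi : 2 * xi (n / a) ≤ a) :
    |1 / (a * (1 - 1 / x)) - 1 / xi (n / a)| ≤ 4 * (xi (n / a) ^ 2 * (1 / a)) := by
  have hu1 : (1 : ℝ) < n / a := lt_of_lt_of_le (Real.one_lt_exp_iff.2 (by norm_num)) hu
  have hσ2 := two_le_scaled hx ha hs hu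
  have hσξ := scaled_le_xi hx (by omega) hs hu1
  have hpow := pow_eq_one_add hx (by omega) hs
  have hξ := (xi_spec (by linarith) hu1.ne').2
  have ha' : (4 : ℝ) ≤ a := by exact_mod_cast ha
  have hx0 : 0 < x := by linarith
  have hx1 : a * (x - 1) = a * (1 - 1 / x) * x := by field_simp
  set u : ℝ := n / a
  set σ := a * (1 - 1 / x) with hσ
  set ξ := xi u
  -- From `σ ≤ ξ ≤ a/2`, that is `1 - 1/x ≤ 1/2`.
  have hx2 : x ≤ 2 := by nlinarith
  have hσ0 : 0 < σ := by linarith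
  have hξ0 : 0 < ξ := by linarith
  -- compare the logarithms of the two defining equations
  have hL : a * Real.log x ≤ σ * x := by
    have := Real.log_le_sub_one_of_pos hx0
    nlinarith
  have hlogσ : Real.log (1 + u * σ) = a * Real.log x := by rw [← hpow, Real.log_pow]
  have hlogξ : Real.log (1 + u * ξ) = ξ := by rw [← hξ, Real.log_exp]
  -- As `σ ≥ 2`, the function `t ↦ log(1 + ut)` has slope at most `1/2` beyond `σ`. Half of `ξ - σ`
  -- can therefore be absorbed, leaving twice the error `σx - σ = σ²x/a` of replacing `a log x` by
  -- `σ`.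
  have hratio : Real.log (1 + u * ξ) - Real.log (1 + u * σ) ≤ (ξ - σ) / 2 := by
    rw [← Real.log_div (by positivity) (by positivity)]
    refine (Real.log_le_sub_one_of_pos (by positivity)).trans ?_
    rw [div_sub_one (by positivity), div_le_div_iff₀ (by positivity) (by norm_num)]
    nlinarith [mul_nonneg (sub_nonneg.2 hσξ) (by nlinarith : (0 : ℝ) ≤ 1 + u * σ - 2 * u)]
  have hdiff : ξ - σ ≤ 2 * (σ * x - σ) := by linarith
  have hfin : a * (ξ - σ) ≤ 4 * ξ ^ 2 := by
    have e : a * (σ * x - σ) = σ ^ 2 * x := by linear_combination σ * hx1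
    have h1 : a * (ξ - σ) ≤ 2 * (σ ^ 2 * x) := by
      have := mul_le_mul_of_nonneg_left hdiff (by linarith : (0 : ℝ) ≤ a)
      linarith
    have h2 : σ ^ 2 ≤ ξ ^ 2 := by gcongr
    nlinarith [sq_nonneg σ]
  have h3 : 1 / σ - 1 / ξ = (ξ - σ) / (σ * ξ) := by field_simp
  rw [h3, abs_of_nonneg (div_nonneg (by linarith) (by positivity))]
  have h4 : (ξ - σ) / (σ * ξ) ≤ ξ - σ :=
    div_le_self (by linarith) (by nlinarith)
  refine h4.trans ?_
  rw [mul_one_div, ← mul_div_assoc, le_div_iff₀ (by linarith)]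
  linarith

theorem sum_pow_div_le (hx : 1 ≤ x) (J : ℕ) :
    ∑ j ∈ Finset.Icc 1 J, x ^ j / (j : ℝ) ≤ x ^ J * (1 + Real.log J) := by
  have h := harmonic_le_one_add_log J
  rw [harmonic_eq_sum_Icc] at h
  push_cast at h
  calc ∑ j ∈ Finset.Icc 1 J, x ^ j / (j : ℝ) ≤ ∑ j ∈ Finset.Icc 1 J, x ^ J * (j : ℝ)⁻¹ := by
        refine Finset.sum_le_sum fun j hj => ?_
        rw [div_eq_mul_inv]
        gcongr
        exact (Finset.mem_Icc.1 hj).2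
    _ = x ^ J * ∑ j ∈ Finset.Icc 1 J, (j : ℝ)⁻¹ := by rw [Finset.mul_sum]
    _ ≤ _ := by gcongr

/-- The square root of `x^a = 1 + uσ ≤ 1 + uξ = exp ξ`; rounding `a/2` down only helps because `x >
1`. -/
theorem pow_half_le_exp (hx : 1 < x) (ha : 0 < a) (hs : ∑ j ∈ Finset.Icc 1 a, x ^ j = n)
    (hu : (1 : ℝ) < n / a) : x ^ (a / 2) ≤ Real.exp (xi (n / a) / 2) := by
  have h1 : x ^ a ≤ Real.exp (xi (n / a)) := by
    rw [(xi_spec (by linarith) hu.ne').2, pow_eq_one_add hx ha hs]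
    gcongr
    exact scaled_le_xi hx ha hs hu
  refine (pow_le_pow_iff_left₀ (by positivity) (Real.exp_pos _).le two_ne_zero).1 ?_
  rw [← pow_mul, ← Real.exp_nat_mul]
  refine (pow_le_pow_right₀ hx.le (Nat.div_mul_le_self a 2)).trans (h1.trans_eq ?_)
  congr 1
  push_cast
  ring

/-- Implicit differentiation of `∑ x(w)^j = n/w` at `w = 1` gives `x' ∑ j x^(j-1) = -n`. -/
theorem var_eq {α : ℕ → ℕ} (hn : 1 ≤ n) (ha : 1 ≤ α n) :
    var α n = mean α n -
      (n : ℝ) ^ 2 / ∑ j ∈ Finset.Icc 1 (α n), (j : ℝ) * saddle α n 1 ^ j := by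
  have hd := (saddle_differentiableAt hn ha one_pos).hasDerivAt
  have hx := (saddle_spec hn ha one_pos).1
  have h1 : HasDerivAt (fun w : ℝ => ∑ j ∈ Finset.Icc 1 (α n), saddle α n w ^ j)
      (∑ j ∈ Finset.Icc 1 (α n), (j : ℝ) * saddle α n 1 ^ (j - 1) *
        deriv (fun w : ℝ => saddle α n w) 1) 1 :=
    HasDerivAt.fun_sum fun j _ => hd.pow j
  have h2 : HasDerivAt (fun w : ℝ => (n : ℝ) / w) (-(n : ℝ)) 1 := by
    simpa [div_eq_mul_inv] using (hasDerivAt_inv (one_ne_zero (α := ℝ))).const_mul (n : ℝ)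
  have heq : (fun w : ℝ => ∑ j ∈ Finset.Icc 1 (α n), saddle α n w ^ j) =ᶠ[𝓝 1]
      fun w : ℝ => (n : ℝ) / w := by
    filter_upwards [lt_mem_nhds one_pos] with w hw
    exact (saddle_spec hn ha hw).2
  have h3 := (h1.congr_of_eventuallyEq heq.symm).unique h2
  set x := saddle α n 1
  set D := deriv (fun w : ℝ => saddle α n w) 1
  have h4 : (∑ j ∈ Finset.Icc 1 (α n), (j : ℝ) * x ^ j) * D = -(n : ℝ) * x := by
    rw [← h3, Finset.sum_mul, Finset.sum_mul]
    refine Finset.sum_congr rfl fun j hj => ?_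
    obtain ⟨i, rfl⟩ := Nat.exists_eq_succ_of_ne_zero (by have := (Finset.mem_Icc.1 hj).1; omega :
      j ≠ 0)
    simp only [Nat.succ_eq_add_one, add_tsub_cancel_right, pow_succ]
    ring
  have hpos : 0 < ∑ j ∈ Finset.Icc 1 (α n), (j : ℝ) * x ^ j := by
    refine Finset.sum_pos (fun j hj => ?_) ⟨1, by simp [ha]⟩
    have : 0 < j := (Finset.mem_Icc.1 hj).1
    positivity
  rw [var, sub_eq_add_neg]
  congr 1
  change n * (D / x) = _
  field_simp
  linear_combination h4

end Pointwise

end CycleRestricted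

namespace CycleRestricted

/-! ### Equality up to superpolynomially small terms -/

section SuperpolyEq

variable {ι : Type*} {l : Filter ι} {κ f f' g g' : ι → ℝ}

theorem superpolynomialDecay_of_isBigO (hf : SuperpolynomialDecay l κ f) (h : g =O[l] f) :
    SuperpolynomialDecay l κ g := fun n =>
  ((isBigO_refl (fun i => κ i ^ n) l).mul h).trans_tendsto (hf n)

theorem superpolynomialDecay_mul_bounded (hf : SuperpolynomialDecay l κ f)
    (h : g =O[l] fun _ => (1 : ℝ)) : SuperpolynomialDecay l κ fun i => f i * g i :=
  superpolynomialDecay_of_isBigO hf (by simpa using (isBigO_refl f l).mul h)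

theorem superpolynomialDecay_exp_neg (hκ : Tendsto κ l atTop) {c : ℝ} (hc : 0 < c) :
    SuperpolynomialDecay l κ fun i => Real.exp (-c * κ i) := fun n => by
  have := (tendsto_rpow_mul_exp_neg_mul_atTop_nhds_zero n c hc).comp hκ
  simpa only [Function.comp_def, Real.rpow_natCast] using this

/-- `f` and `g` differ by a term that decays faster than every power of `κ`. -/
def SuperpolyEq (l : Filter ι) (κ f g : ι → ℝ) : Prop :=
  SuperpolynomialDecay l κ fun i => f i - g i

theorem SuperpolyEq.refl (l : Filter ι) (κ f : ι → ℝ) : SuperpolyEq l κ f f :=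
  (superpolynomialDecay_zero l κ).congr fun i => by simp

theorem SuperpolyEq.add (hf : SuperpolyEq l κ f f') (hg : SuperpolyEq l κ g g') :
    SuperpolyEq l κ (fun i => f i + g i) (fun i => f' i + g' i) :=
  (SuperpolynomialDecay.add hf hg).congr fun i => by simp only [Pi.add_apply]; ring

theorem SuperpolyEq.sub (hf : SuperpolyEq l κ f f') (hg : SuperpolyEq l κ g g') :
    SuperpolyEq l κ (fun i => f i - g i) (fun i => f' i - g' i) :=
  (SuperpolynomialDecay.add hf (SuperpolynomialDecay.const_mul hg (-1))).congr fun i => by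
    simp only [Pi.add_apply]; ring

/-- The zeroth power of `κ` in the decay condition already says `f - f' → 0`. Thus in products only
the reference functions need to be known to be bounded. -/
theorem SuperpolyEq.isBigO_one (hf : SuperpolyEq l κ f f') (h : f' =O[l] fun _ => (1 : ℝ)) :
    f =O[l] fun _ => (1 : ℝ) := by
  have h0 : Tendsto (fun i => f i - f' i) l (𝓝 0) := by simpa using hf 0
  simpa using (h0.isBigO_one ℝ).add h

theorem SuperpolyEq.mul (hf : SuperpolyEq l κ f f') (hg : SuperpolyEq l κ g g')
    (hf' : f' =O[l] fun _ => (1 : ℝ)) (hg' : g' =O[l] fun _ => (1 : ℝ)) :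
    SuperpolyEq l κ (fun i => f i * g i) (fun i => f' i * g' i) :=
  (SuperpolynomialDecay.add (superpolynomialDecay_mul_bounded hf (hg.isBigO_one hg'))
    (superpolynomialDecay_mul_bounded hg hf')).congr fun i => by
      simp only [Pi.add_apply]; ring

theorem SuperpolyEq.const_mul (hf : SuperpolyEq l κ f f') (c : ℝ) :
    SuperpolyEq l κ (fun i => c * f i) (fun i => c * f' i) :=
  (SuperpolynomialDecay.const_mul hf c).congr fun i => by ring

theorem isBigO_one_pow (h : f =O[l] fun _ => (1 : ℝ)) (k : ℕ) :
    (fun i => f i ^ k) =O[l] fun _ => (1 : ℝ) := by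
  simpa using h.pow k

theorem SuperpolyEq.pow (hf : SuperpolyEq l κ f f') (hf' : f' =O[l] fun _ => (1 : ℝ)) (k : ℕ) :
    SuperpolyEq l κ (fun i => f i ^ k) (fun i => f' i ^ k) := by
  induction k with
  | zero => simpa using SuperpolyEq.refl l κ fun _ => 1
  | succ k ih =>
    simp only [pow_succ]
    exact ih.mul hf (isBigO_one_pow hf' k) hf'

theorem SuperpolyEq.sum {σ : Type*} (s : Finset σ) {F F' : σ → ι → ℝ}
    (h : ∀ k ∈ s, SuperpolyEq l κ (F k) (F' k)) :
    SuperpolyEq l κ (fun i => ∑ k ∈ s, F k i) (fun i => ∑ k ∈ s, F' k i) := by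
  classical
  induction s using Finset.induction_on with
  | empty => simpa using SuperpolyEq.refl l κ fun _ => 0
  | insert k s hk ih =>
    simp only [Finset.sum_insert hk]
    exact (h k (Finset.mem_insert_self k s)).add
      (ih fun j hj => h j (Finset.mem_insert_of_mem hj))

theorem SuperpolyEq.inv (hf : SuperpolyEq l κ f f') (h0 : ∀ᶠ i in l, f i ≠ 0)
    (h0' : ∀ᶠ i in l, f' i ≠ 0) (hb : (fun i => (f i)⁻¹) =O[l] fun _ => (1 : ℝ))
    (hb' : (fun i => (f' i)⁻¹) =O[l] fun _ => (1 : ℝ)) :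
    SuperpolyEq l κ (fun i => (f i)⁻¹) (fun i => (f' i)⁻¹) := by
  have h1 : (fun i => -((f i)⁻¹ * (f' i)⁻¹)) =O[l] fun _ => (1 : ℝ) := by
    simpa using (hb.mul hb').neg_left
  refine (superpolynomialDecay_mul_bounded hf h1).congr' ?_
  filter_upwards [h0, h0'] with i hi hi'
  field_simp
  ring

theorem SuperpolynomialDecay.isBigO_inv_pow (hκ : Tendsto κ l atTop)
    (hf : SuperpolynomialDecay l κ f) (K : ℕ) : f =O[l] fun i => (1 / κ i) ^ K := by
  have := (superpolynomialDecay_iff_isBigO f hκ).1 hf (-(K : ℤ))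
  simpa using this

/-- Remainders of the order of the first omitted term give an asymptotic expansion. -/
theorem isAsymptoticExpansion_of_isBigO {u : ι → ℝ} {k₀ : ℕ} {c : ℕ → ℝ}
    (hκ : Tendsto κ l atTop) (hu : ∀ᶠ i in l, u i ≠ 0)
    (h : ∀ N, k₀ ≤ N → (fun i => f i / u i - ∑ k ∈ Finset.Icc k₀ N, c k * (1 / κ i) ^ k) =O[l]
      fun i => (1 / κ i) ^ (N + 1)) :
    IsAsymptoticExpansion l f k₀ c (fun k i => u i * (1 / κ i ^ k)) := by
  have hinv : (fun i => 1 / κ i) =o[l] fun _ => (1 : ℝ) := by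
    simp only [isLittleO_one_iff, one_div]
    exact hκ.inv_tendsto_atTop
  have hstep : ∀ k : ℕ, (fun i => u i * (1 / κ i) ^ (k + 1)) =o[l]
      fun i => u i * (1 / κ i ^ k) := fun k => by
    have := (isBigO_refl (fun i => u i * (1 / κ i ^ k)) l).mul_isLittleO hinv
    refine this.congr (fun i => ?_) fun i => mul_one _
    rw [one_div_pow, pow_succ]
    ring
  refine ⟨fun k _ => by simpa using hstep k, fun N hN => ?_⟩
  refine IsBigO.trans_isLittleO ?_ (hstep N)
  refine ((isBigO_refl u l).mul (h N hN)).congr' ?_ EventuallyEq.rfl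
  filter_upwards [hu] with i hi
  rw [mul_sub, mul_div_cancel₀ _ hi, Finset.mul_sum]
  congr 1
  refine Finset.sum_congr rfl fun k _ => ?_
  rw [one_div_pow]
  ring

end SuperpolyEq

/-! ### Growth of `ξ` -/

theorem log_le_xi {u : ℝ} (hu : 1 < u) : Real.log u ≤ xi u := by
  have hu0 : 0 < u := by linarith
  refine le_xi_of_exp_le hu (Real.log_pos hu) ?_
  rw [Real.exp_log hu0]
  have := mul_le_mul_of_nonneg_left (Real.one_sub_inv_le_log_of_pos hu0) hu0.le
  rw [mul_sub, mul_inv_cancel₀ hu0.ne'] at this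
  linarith

/-- The quadratic lower bound for `exp` gives `ξ ≤ 2u - 2`; inserting this into `exp ξ = 1 + uξ`
gives `exp ξ ≤ u³`. -/
theorem xi_le_log {u : ℝ} (hu : 2 ≤ u) : xi u ≤ 3 * Real.log u := by
  have hξ := xi_pos (by linarith : 1 < u)
  have h := (xi_spec (by linarith) (by linarith : u ≠ 1)).2
  have h1 := Real.quadratic_le_exp_of_nonneg hξ.le
  have h2 : xi u ≤ 2 * u - 2 := by
    rw [h] at h1
    nlinarith
  have h3 : Real.exp (xi u) ≤ u ^ 3 := by
    rw [h]
    nlinarith [mul_le_mul_of_nonneg_left h2 (by linarith : (0 : ℝ) ≤ u),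
      mul_nonneg (sub_nonneg.2 hu) (sq_nonneg u)]
  have := (Real.le_log_iff_exp_le (by positivity)).2 h3
  rw [Real.log_pow] at this
  exact_mod_cast this

theorem one_div_le_xi_mul_exp {u : ℝ} (hu : 1 < u) (hξ : 1 ≤ xi u) :
    1 / u ≤ 2 * xi u * Real.exp (-xi u) := by
  have h := (xi_spec (by linarith) hu.ne').2
  have h1 := Real.add_one_le_exp (xi u)
  rw [Real.exp_neg, ← div_eq_mul_inv, div_le_div_iff₀ (by linarith) (Real.exp_pos _)]
  nlinarith

/-! ### The growth conditions -/

section Growth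

variable {α : ℕ → ℕ} {α₀ α₁ : ℝ}

theorem eventually_rpow_le
    (hlow : Tendsto (fun n : ℕ => (n : ℝ) ^ (-α₀) * (α n : ℝ)) atTop atTop) :
    ∀ᶠ n : ℕ in atTop, (n : ℝ) ^ α₀ ≤ α n := by
  filter_upwards [hlow.eventually_ge_atTop 1, eventually_ge_atTop 1] with n h hn
  have hn' : (0 : ℝ) < n := by exact_mod_cast hn
  rw [Real.rpow_neg hn'.le, ← div_eq_inv_mul, le_div_iff₀ (by positivity), one_mul] at h
  exact h

theorem eventually_rpow_le_div
    (hupp : Tendsto (fun n : ℕ => (n : ℝ) ^ (-α₁) * (α n : ℝ)) atTop (𝓝 0))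
    (hpos : ∀ᶠ n : ℕ in atTop, 0 < α n) :
    ∀ᶠ n : ℕ in atTop, (n : ℝ) ^ (1 - α₁) ≤ n / α n := by
  filter_upwards [hupp.eventually_le_const one_pos, eventually_ge_atTop 1, hpos] with n h hn ha
  have hn' : (0 : ℝ) < n := by exact_mod_cast hn
  have ha' : (0 : ℝ) < α n := by exact_mod_cast ha
  rw [Real.rpow_neg hn'.le, ← div_eq_inv_mul, div_le_iff₀ (by positivity), one_mul] at h
  rw [Real.rpow_sub hn', Real.rpow_one]
  gcongr

theorem tendsto_cycleLength (hα₀ : 0 < α₀)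
    (hlow : Tendsto (fun n : ℕ => (n : ℝ) ^ (-α₀) * (α n : ℝ)) atTop atTop) :
    Tendsto (fun n => (α n : ℝ)) atTop atTop :=
  tendsto_atTop_mono' _ (eventually_rpow_le hlow)
    ((tendsto_rpow_atTop hα₀).comp tendsto_natCast_atTop_atTop)

theorem tendsto_ratio (hα₁ : α₁ < 1)
    (hupp : Tendsto (fun n : ℕ => (n : ℝ) ^ (-α₁) * (α n : ℝ)) atTop (𝓝 0))
    (hpos : ∀ᶠ n : ℕ in atTop, 0 < α n) :
    Tendsto (fun n : ℕ => (n : ℝ) / α n) atTop atTop :=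
  tendsto_atTop_mono' _ (eventually_rpow_le_div hupp hpos)
    ((tendsto_rpow_atTop (by linarith)).comp tendsto_natCast_atTop_atTop)

theorem tendsto_xi_ratio (hu : Tendsto (fun n : ℕ => (n : ℝ) / α n) atTop atTop) :
    Tendsto (fun n : ℕ => xi ((n : ℝ) / α n)) atTop atTop :=
  tendsto_atTop_mono' _ ((hu.eventually_gt_atTop 1).mono fun _ h => log_le_xi h)
    (Real.tendsto_log_atTop.comp hu)

theorem superpolynomialDecay_one_div_ratio
    (hu : Tendsto (fun n : ℕ => (n : ℝ) / α n) atTop atTop) :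
    SuperpolynomialDecay atTop (fun n : ℕ => xi ((n : ℝ) / α n))
      fun n => 1 / ((n : ℝ) / α n) := by
  have hξ := tendsto_xi_ratio hu
  have h1 := ((superpolynomialDecay_exp_neg hξ one_pos).mul_param).const_mul 2
  refine h1.trans_eventually_abs_le ?_
  filter_upwards [hu.eventually_gt_atTop 1, hξ.eventually_ge_atTop 1] with n hn hn'
  have h := one_div_le_xi_mul_exp hn hn'
  simp only [Function.comp_apply, Pi.mul_apply]
  rw [abs_of_pos (by positivity)]
  refine le_trans (h.trans_eq ?_) (le_abs_self _)
  rw [neg_one_mul]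
  ring

/-- Combine `1/a ≤ n^(-α₀) = exp(-α₀ log n)` with `ξ ≤ 3 log u ≤ 3 log n`; this is the origin of the
rate `α₀/3`. -/
theorem superpolynomialDecay_one_div_cycleLength (hα₀ : 0 < α₀)
    (hlow : Tendsto (fun n : ℕ => (n : ℝ) ^ (-α₀) * (α n : ℝ)) atTop atTop)
    (hu : Tendsto (fun n : ℕ => (n : ℝ) / α n) atTop atTop) :
    SuperpolynomialDecay atTop (fun n : ℕ => xi ((n : ℝ) / α n)) fun n => 1 / (α n : ℝ) := by
  have hξ := tendsto_xi_ratio hu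
  refine (superpolynomialDecay_exp_neg hξ (c := α₀ / 3) (by positivity)).trans_eventually_abs_le ?_
  filter_upwards [hu.eventually_ge_atTop 2, eventually_rpow_le hlow, eventually_ge_atTop 1,
    (tendsto_cycleLength hα₀ hlow).eventually_ge_atTop 1] with n hn hn' h1 ha
  have hn0 : (0 : ℝ) < n := by exact_mod_cast h1
  simp only [Function.comp_apply]
  rw [abs_of_pos (by positivity), abs_of_pos (Real.exp_pos _)]
  have h2 : xi ((n : ℝ) / α n) ≤ 3 * Real.log n := by
    refine (xi_le_log hn).trans ?_
    gcongr
    exact div_le_self hn0.le ha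
  calc 1 / (α n : ℝ) ≤ 1 / (n : ℝ) ^ α₀ := by gcongr
    _ = Real.exp (-(Real.log n * α₀)) := by
      rw [Real.rpow_def_of_pos hn0, Real.exp_neg, one_div]
    _ ≤ _ := by
      gcongr
      nlinarith

end Growth

end CycleRestricted

namespace CycleRestricted

/-! ### The exact decomposition of the mean -/

section Decomposition

variable {a n : ℕ} {x : ℝ}

/-- The reason for cutting the sum at `a/2`: from there on the rising factorials are at least
`(a/2)^k`, uniformly in `j`. -/
theorem pow_div_ascFactorial_le {j : ℕ} (hj : a ≤ 2 * j) (hj0 : 0 < j) (k : ℕ) :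
    (a : ℝ) ^ k * ((j.ascFactorial k : ℕ) : ℝ)⁻¹ ≤ 2 ^ k := by
  have h1 : (j : ℝ) ^ k ≤ (j.ascFactorial k : ℕ) := by
    exact_mod_cast Nat.pow_succ_le_ascFactorial j k
  have hj0' : (0 : ℝ) < j := by exact_mod_cast hj0
  rw [← div_eq_mul_inv, div_le_iff₀ (lt_of_lt_of_le (by positivity) h1)]
  calc (a : ℝ) ^ k ≤ (2 * j) ^ k := by gcongr; exact_mod_cast hj
    _ = 2 ^ k * (j : ℝ) ^ k := mul_pow _ _ _
    _ ≤ _ := by gcongr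

/-- Rests on `x/(x - 1) = pa` and `p x^a/u = 1 + p/u`. The three groups are the boundary terms at
`a`, which carry the expansion; the head together with the boundary terms at `a/2`, which are
negligible; and the remainder of order `p^K`. -/
theorem sum_pow_div_ratio_eq (hx : 1 < x) (ha : 0 < a) (hn : 0 < n)
    (hs : ∑ j ∈ Finset.Icc 1 a, x ^ j = n) (K : ℕ) {p u : ℝ} (hp : p = 1 / (a * (1 - 1 / x)))
    (hu : u = n / a) :
    (∑ j ∈ Finset.Icc 1 a, x ^ j / (j : ℝ)) / u =
      ∑ k ∈ Finset.range K, (k.factorial : ℝ) * (p ^ k * ((1 + p * (1 / u)) *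
        ((a : ℝ) ^ (k + 1) * (((a + 1).ascFactorial (k + 1) : ℕ) : ℝ)⁻¹))) +
      ((∑ j ∈ Finset.Icc 1 (a / 2), x ^ j / (j : ℝ)) / u -
        ∑ k ∈ Finset.range K, (k.factorial : ℝ) * ((x ^ (a / 2) / u) * (p ^ (k + 1) *
          ((a : ℝ) ^ (k + 1) * (((a / 2 + 1).ascFactorial (k + 1) : ℕ) : ℝ)⁻¹)))) +
      (K.factorial : ℝ) * (p ^ K * ((a : ℝ) ^ K *
        (∑ j ∈ Finset.Ioc (a / 2) a, x ^ j * ((j.ascFactorial (K + 1) : ℕ) : ℝ)⁻¹) / u)) := by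
  have hsplit : ∑ j ∈ Finset.Icc 1 a, x ^ j / (j : ℝ) =
      ∑ j ∈ Finset.Icc 1 (a / 2), x ^ j / (j : ℝ) + ∑ j ∈ Finset.Ioc (a / 2) a, x ^ j / (j : ℝ) := by
    have := Finset.sum_Ioc_consecutive (fun j : ℕ => x ^ j / (j : ℝ)) (Nat.zero_le (a / 2))
      (Nat.div_le_self a 2)
    simpa only [← Finset.Icc_add_one_left_eq_Ioc, zero_add] using this.symm
  have ha' : (0 : ℝ) < a := by exact_mod_cast ha
  have hn' : (0 : ℝ) < n := by exact_mod_cast hn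
  have hu0 : 0 < u := hu ▸ by positivity
  have hx1 : x - 1 ≠ 0 := by linarith
  have hx2 : 1 - 1 / x = (x - 1) / x := by field_simp
  have hp0 : p ≠ 0 := by
    rw [hp, hx2]
    positivity
  have hq : x / (x - 1) = p * a := by
    rw [hp, hx2]
    field_simp
  have hpow : p * (x ^ a / u) = 1 + p * (1 / u) := by
    rw [pow_eq_one_add hx ha hs, ← hu, hp, hx2]
    field_simp
    ring
  have hmain : (∑ k ∈ Finset.range K, (k.factorial : ℝ) * (p * a) ^ (k + 1) *
        (x ^ a * (((a + 1).ascFactorial (k + 1) : ℕ) : ℝ)⁻¹ -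
          x ^ (a / 2) * (((a / 2 + 1).ascFactorial (k + 1) : ℕ) : ℝ)⁻¹)) / u =
      ∑ k ∈ Finset.range K, (k.factorial : ℝ) * (p ^ k * ((1 + p * (1 / u)) *
        ((a : ℝ) ^ (k + 1) * (((a + 1).ascFactorial (k + 1) : ℕ) : ℝ)⁻¹))) -
      ∑ k ∈ Finset.range K, (k.factorial : ℝ) * ((x ^ (a / 2) / u) * (p ^ (k + 1) *
        ((a : ℝ) ^ (k + 1) * (((a / 2 + 1).ascFactorial (k + 1) : ℕ) : ℝ)⁻¹))) := by
    rw [← Finset.sum_sub_distrib, Finset.sum_div, ← hpow]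
    refine Finset.sum_congr rfl fun k _ => ?_
    ring
  rw [hsplit, sum_pow_div_eq hx.ne' (Nat.div_le_self a 2) K, hq, add_div, add_div, hmain]
  ring

theorem pow_mul_sum_div_le (hx : 1 < x) (ha : 0 < a) (hn : 0 < n)
    (hs : ∑ j ∈ Finset.Icc 1 a, x ^ j = n) (K : ℕ) :
    (a : ℝ) ^ K * (∑ j ∈ Finset.Ioc (a / 2) a, x ^ j * ((j.ascFactorial (K + 1) : ℕ) : ℝ)⁻¹) /
      (n / a) ≤ 2 ^ (K + 1) := by
  have ha' : (0 : ℝ) < a := by exact_mod_cast ha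
  have hn' : (0 : ℝ) < n := by exact_mod_cast hn
  have hx0 : 0 < x := by linarith
  have h1 : (a : ℝ) ^ (K + 1) *
      ∑ j ∈ Finset.Ioc (a / 2) a, x ^ j * ((j.ascFactorial (K + 1) : ℕ) : ℝ)⁻¹ ≤
        2 ^ (K + 1) * n := by
    rw [← hs, Finset.mul_sum, Finset.mul_sum]
    calc _ ≤ ∑ j ∈ Finset.Ioc (a / 2) a, (2 : ℝ) ^ (K + 1) * x ^ j := by
          refine Finset.sum_le_sum fun j hj => ?_
          have hj' := Finset.mem_Ioc.1 hj
          have := pow_div_ascFactorial_le (a := a) (j := j) (by omega) (by omega) (K + 1)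
          calc _ = (a : ℝ) ^ (K + 1) * ((j.ascFactorial (K + 1) : ℕ) : ℝ)⁻¹ * x ^ j := by ring
            _ ≤ _ := by gcongr
      _ ≤ _ := by
          refine Finset.sum_le_sum_of_subset_of_nonneg (fun j hj => ?_) fun j _ _ => by positivity
          have hj' := Finset.mem_Ioc.1 hj
          exact Finset.mem_Icc.2 ⟨by omega, hj'.2⟩
  rw [div_le_iff₀ (by positivity), ← mul_div_assoc, le_div_iff₀ ha']
  calc _ = _ := by rw [pow_succ]; ring
    _ ≤ _ := h1

end Decomposition

/-! ### The expansions -/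

section Expansion

variable {α : ℕ → ℕ}

/-- The length scale `x / (x - 1)` of the saddle point `x = x_{n,α}(1)`, divided by `α(n)`. -/
noncomputable def relScale (α : ℕ → ℕ) (n : ℕ) : ℝ := 1 / (α n * (1 - 1 / saddle α n 1))

/-- The conditions under which the expansions are derived: `1 / α(n)` is negligible with respect
to powers of `ξ(n / α(n))`, and `log n` is at most of the order of `ξ(n / α(n))`. -/
structure Admissible (α : ℕ → ℕ) : Prop where
  ratio : Tendsto (fun n : ℕ => (n : ℝ) / α n) atTop atTop
  length : SuperpolynomialDecay atTop (fun n : ℕ => xi ((n : ℝ) / α n)) fun n => 1 / (α n : ℝ)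
  length_ge : ∀ᶠ n in atTop, 4 ≤ α n
  log_le : ∃ C : ℝ, ∀ᶠ n in atTop, Real.log (α n) ≤ C * xi ((n : ℝ) / α n)

theorem admissible_of_rpow {α₀ α₁ : ℝ} (hα₀ : 0 < α₀) (hα₁ : α₁ < 1)
    (hlow : Tendsto (fun n : ℕ => (n : ℝ) ^ (-α₀) * (α n : ℝ)) atTop atTop)
    (hupp : Tendsto (fun n : ℕ => (n : ℝ) ^ (-α₁) * (α n : ℝ)) atTop (𝓝 0)) : Admissible α := by
  have hge : ∀ᶠ n in atTop, 4 ≤ α n := by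
    filter_upwards [(tendsto_cycleLength hα₀ hlow).eventually_ge_atTop 4] with n h
    exact_mod_cast h
  have hpos : ∀ᶠ n in atTop, 0 < α n := hge.mono fun n h => by omega
  have hu := tendsto_ratio hα₁ hupp hpos
  -- The constant `(1 - α₁)⁻¹` comes from `ξ ≥ log u ≥ (1 - α₁) log n` and `a ≤ n`.
  refine ⟨hu, superpolynomialDecay_one_div_cycleLength hα₀ hlow hu, hge, (1 - α₁)⁻¹, ?_⟩
  filter_upwards [hu.eventually_gt_atTop 1, hpos, eventually_rpow_le_div hupp hpos,
    eventually_ge_atTop 1] with n h1 h2 h3 h4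
  have hn : (0 : ℝ) < n := by exact_mod_cast h4
  have ha : (0 : ℝ) < α n := by exact_mod_cast h2
  have h5 : (1 - α₁) * Real.log n ≤ xi ((n : ℝ) / α n) := by
    rw [← Real.log_rpow hn]
    exact (Real.log_le_log (by positivity) h3).trans (log_le_xi h1)
  have h6 : Real.log (α n) ≤ Real.log n := by
    rw [one_lt_div ha] at h1
    exact Real.log_le_log ha h1.le
  rw [← div_eq_inv_mul, le_div_iff₀ (by linarith)]
  nlinarith

namespace Admissible

theorem xi_tendsto (h : Admissible α) :
    Tendsto (fun n : ℕ => xi ((n : ℝ) / α n)) atTop atTop := tendsto_xi_ratio h.ratio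

theorem inv_xi_isBigO_one (h : Admissible α) :
    (fun n : ℕ => 1 / xi ((n : ℝ) / α n)) =O[atTop] fun _ => (1 : ℝ) := by
  have : Tendsto (fun n : ℕ => 1 / xi ((n : ℝ) / α n)) atTop (𝓝 0) := by
    simp only [one_div]
    exact h.xi_tendsto.inv_tendsto_atTop
  exact this.isBigO_one ℝ

theorem eventually_saddle (h : Admissible α) : ∀ᶠ n : ℕ in atTop, 1 ≤ n ∧ 4 ≤ α n ∧
    1 < saddle α n 1 ∧ ∑ j ∈ Finset.Icc 1 (α n), saddle α n 1 ^ j = n ∧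
    Real.exp 4 ≤ (n : ℝ) / α n ∧ 1 < (n : ℝ) / α n ∧ 1 ≤ xi ((n : ℝ) / α n) := by
  filter_upwards [h.length_ge, h.ratio.eventually_ge_atTop (Real.exp 4), eventually_ge_atTop 1,
    h.xi_tendsto.eventually_ge_atTop 1] with n ha hu hn hξ
  have hu1 : (1 : ℝ) < n / α n := lt_of_lt_of_le (Real.one_lt_exp_iff.2 (by norm_num)) hu
  obtain ⟨hx0, hs⟩ := saddle_spec hn (by omega : 1 ≤ α n) one_pos
  rw [div_one] at hs
  have ha' : (0 : ℝ) < α n := by exact_mod_cast (by omega : 0 < α n)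
  have han : α n < n := by
    rw [one_lt_div ha'] at hu1
    exact_mod_cast hu1
  exact ⟨hn, ha, one_lt_of_sum_pow_eq hx0 hs han, hs, hu, hu1, hξ⟩

theorem relScale_mem (h : Admissible α) :
    ∀ᶠ n : ℕ in atTop, 0 < relScale α n ∧ relScale α n ≤ 1 / 2 := by
  filter_upwards [h.eventually_saddle] with n ⟨_, ha, hx, hs, hu, _, _⟩
  have := two_le_scaled hx ha hs hu
  exact ⟨one_div_pos.2 (by linarith), one_div_le_one_div_of_le two_pos this⟩

theorem relScale_eq (h : Admissible α) :
    SuperpolyEq atTop (fun n : ℕ => xi ((n : ℝ) / α n)) (relScale α)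
      fun n => 1 / xi ((n : ℝ) / α n) := by
  have h1 : Tendsto (fun n : ℕ => xi ((n : ℝ) / α n) * (1 / (α n : ℝ))) atTop (𝓝 0) := by
    simpa only [pow_one] using h.length 1
  refine ((h.length.param_pow_mul 2).const_mul 4).trans_eventually_abs_le ?_
  filter_upwards [h.eventually_saddle, h1.eventually_le_const (by norm_num : (0 : ℝ) < 1 / 2)]
    with n ⟨_, ha, hx, hs, hu, _, _⟩ h2
  have ha' : (0 : ℝ) < α n := by exact_mod_cast (by omega : 0 < α n)
  rw [mul_one_div, div_le_iff₀ ha'] at h2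
  exact (abs_inv_scaled_sub_le hx ha hs hu (by linarith)).trans (le_abs_self _)

theorem relScale_isBigO (h : Admissible α) :
    relScale α =O[atTop] fun n : ℕ => 1 / xi ((n : ℝ) / α n) := by
  have h1 := SuperpolynomialDecay.isBigO_inv_pow h.xi_tendsto h.relScale_eq 1
  simp only [pow_one] at h1
  simpa using h1.add (isBigO_refl (fun n : ℕ => 1 / xi ((n : ℝ) / α n)) atTop)

theorem relScale_isBigO_one (h : Admissible α) : relScale α =O[atTop] fun _ => (1 : ℝ) :=
  h.relScale_isBigO.trans h.inv_xi_isBigO_one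

theorem relScale_mul_eq (h : Admissible α) :
    SuperpolynomialDecay atTop (fun n : ℕ => xi ((n : ℝ) / α n))
      fun n => relScale α n * (1 / ((n : ℝ) / α n)) :=
  (superpolynomialDecay_mul_bounded (superpolynomialDecay_one_div_ratio h.ratio)
    h.relScale_isBigO_one).congr fun _ => mul_comm _ _

/-- The bounds `x^(a/2) ≤ exp(ξ/2)`, `log a ≤ Cξ` and `1/u ≤ 2ξ exp(-ξ)` multiply to `2ξ(1 + Cξ)
exp(-ξ/2)`. This controls both the head of the sum and the boundary terms at `a/2`. -/
theorem head_decay (h : Admissible α) :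
    SuperpolynomialDecay atTop (fun n : ℕ => xi ((n : ℝ) / α n)) fun n =>
      saddle α n 1 ^ (α n / 2) * (1 + Real.log (α n)) / ((n : ℝ) / α n) := by
  obtain ⟨C, hC⟩ := h.log_le
  have he := superpolynomialDecay_exp_neg h.xi_tendsto (c := 1 / 2) (by norm_num)
  refine ((he.mul_param).add ((he.mul_param_pow 2).const_mul C)).const_mul 2
    |>.trans_eventually_abs_le ?_
  filter_upwards [h.eventually_saddle, hC] with n ⟨_, ha, hx, hs, hu, hu1, hξ⟩ hlog
  simp only [Function.comp_apply, Pi.add_apply, Pi.mul_apply, Pi.pow_apply]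
  have h1 := pow_half_le_exp hx (by omega) hs hu1
  have h2 := one_div_le_xi_mul_exp hu1 hξ
  have h3 : 0 ≤ Real.log (α n) := Real.log_natCast_nonneg _
  set ξ := xi ((n : ℝ) / α n)
  have hx0 : 0 < saddle α n 1 := by linarith
  have hexp : Real.exp (ξ / 2) * Real.exp (-ξ) = Real.exp (-(1 / 2) * ξ) := by
    rw [← Real.exp_add]
    congr 1
    ring
  rw [abs_of_nonneg (by positivity), div_eq_mul_one_div]
  refine le_trans ?_ (le_abs_self _)
  have hC0 : 0 ≤ 1 + C * ξ := by linarith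
  calc _ ≤ Real.exp (ξ / 2) * (1 + C * ξ) * (2 * ξ * Real.exp (-ξ)) := by gcongr
    _ = 2 * ξ * (1 + C * ξ) * (Real.exp (ξ / 2) * Real.exp (-ξ)) := by ring
    _ = _ := by rw [hexp]; ring

/-- Each factor `a/(a + 1 + k)` differs from `1` by at most `(1 + k)/a`. -/
theorem coeff_eq (h : Admissible α) (k : ℕ) :
    SuperpolyEq atTop (fun n : ℕ => xi ((n : ℝ) / α n))
      (fun n => (α n : ℝ) ^ k * (((α n + 1).ascFactorial k : ℕ) : ℝ)⁻¹) fun _ => 1 := by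
  have hone : (fun _ : ℕ => (1 : ℝ)) =O[atTop] fun _ => (1 : ℝ) := isBigO_refl _ _
  induction k with
  | zero => simpa using SuperpolyEq.refl _ _ _
  | succ k ih =>
    have h1 : SuperpolyEq atTop (fun n : ℕ => xi ((n : ℝ) / α n))
        (fun n => (α n : ℝ) * (α n + 1 + k : ℝ)⁻¹) fun _ => 1 := by
      refine (h.length.const_mul (1 + k)).trans_eventually_abs_le ?_
      filter_upwards [h.length_ge] with n ha
      have ha' : (0 : ℝ) < α n := by exact_mod_cast (by omega : 0 < α n)
      have e : (α n : ℝ) * (α n + 1 + k : ℝ)⁻¹ - 1 = -((1 + k) / (α n + 1 + k)) := by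
        field_simp
        ring
      simp only [Function.comp_apply]
      rw [e, abs_neg, abs_of_pos (by positivity), abs_of_pos (by positivity), mul_one_div]
      gcongr
      linarith
    have h2 := ih.mul h1 hone hone
    simp only [mul_one] at h2
    refine h2.congr fun n => ?_
    simp only [pow_succ, Nat.ascFactorial_succ, Nat.cast_mul, Nat.cast_add, Nat.cast_one, mul_inv]
    ring

theorem mean_isBigO (h : Admissible α) (K : ℕ) :
    (fun n : ℕ => mean α n / ((n : ℝ) / α n) -
      ∑ k ∈ Finset.range K, (k.factorial : ℝ) * (1 / xi ((n : ℝ) / α n)) ^ k) =O[atTop]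
      fun n => (1 / xi ((n : ℝ) / α n)) ^ K := by
  have hone : (fun _ : ℕ => (1 : ℝ)) =O[atTop] fun _ => (1 : ℝ) := isBigO_refl _ _
  have hp := h.relScale_isBigO_one
  have hmain : SuperpolyEq atTop (fun n : ℕ => xi ((n : ℝ) / α n))
      (fun n => ∑ k ∈ Finset.range K, (k.factorial : ℝ) * (relScale α n ^ k *
        ((1 + relScale α n * (1 / ((n : ℝ) / α n))) *
          ((α n : ℝ) ^ (k + 1) * (((α n + 1).ascFactorial (k + 1) : ℕ) : ℝ)⁻¹))))
      (fun n => ∑ k ∈ Finset.range K, (k.factorial : ℝ) * (1 / xi ((n : ℝ) / α n)) ^ k) := by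
    refine SuperpolyEq.sum _ fun k _ => SuperpolyEq.const_mul ?_ _
    have h1 : SuperpolyEq atTop (fun n : ℕ => xi ((n : ℝ) / α n))
        (fun n => 1 + relScale α n * (1 / ((n : ℝ) / α n))) fun _ => 1 :=
      h.relScale_mul_eq.congr fun n => by ring
    have h2 := (h.relScale_eq.pow h.inv_xi_isBigO_one k).mul
      (h1.mul (h.coeff_eq (k + 1)) hone hone) (isBigO_one_pow h.inv_xi_isBigO_one k)
      (by simpa using hone)
    simpa only [mul_one] using h2
  have hhead : SuperpolynomialDecay atTop (fun n : ℕ => xi ((n : ℝ) / α n)) fun n =>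
      (∑ j ∈ Finset.Icc 1 (α n / 2), saddle α n 1 ^ j / (j : ℝ)) / ((n : ℝ) / α n) := by
    refine h.head_decay.trans_eventually_abs_le ?_
    filter_upwards [h.eventually_saddle] with n ⟨_, ha, hx, _, _, hu1, _⟩
    simp only [Function.comp_apply]
    have hx0 : 0 < saddle α n 1 := by linarith
    have hJ : (0 : ℝ) < (α n / 2 : ℕ) := by exact_mod_cast (by omega : 0 < α n / 2)
    rw [abs_of_nonneg (by positivity)]
    refine le_trans ?_ (le_abs_self _)
    have h1 := sum_pow_div_le hx.le (α n / 2)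
    have h2 : Real.log (α n / 2 : ℕ) ≤ Real.log (α n) :=
      Real.log_le_log hJ (by exact_mod_cast Nat.div_le_self _ _)
    gcongr
    refine h1.trans ?_
    gcongr
  have hpow : SuperpolynomialDecay atTop (fun n : ℕ => xi ((n : ℝ) / α n)) fun n =>
      saddle α n 1 ^ (α n / 2) / ((n : ℝ) / α n) := by
    refine h.head_decay.trans_eventually_abs_le ?_
    filter_upwards [h.eventually_saddle] with n ⟨_, ha, hx, _, _, hu1, _⟩
    simp only [Function.comp_apply]
    have hx0 : 0 < saddle α n 1 := by linarith
    have h3 : 0 ≤ Real.log (α n) := Real.log_natCast_nonneg _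
    rw [abs_of_nonneg (by positivity), abs_of_nonneg (by positivity)]
    gcongr
    exact le_mul_of_one_le_right (by positivity) (by linarith)
  have hbdry : SuperpolyEq atTop (fun n : ℕ => xi ((n : ℝ) / α n))
      (fun n => ∑ k ∈ Finset.range K, (k.factorial : ℝ) *
        ((saddle α n 1 ^ (α n / 2) / ((n : ℝ) / α n)) * (relScale α n ^ (k + 1) *
          ((α n : ℝ) ^ (k + 1) * (((α n / 2 + 1).ascFactorial (k + 1) : ℕ) : ℝ)⁻¹))))
      (fun n => ∑ k ∈ Finset.range K, (k.factorial : ℝ) * 0) := by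
    refine SuperpolyEq.sum _ fun k _ => SuperpolyEq.const_mul ?_ _
    have hd : (fun n : ℕ => (α n : ℝ) ^ (k + 1) *
        (((α n / 2 + 1).ascFactorial (k + 1) : ℕ) : ℝ)⁻¹) =O[atTop] fun _ => (1 : ℝ) := by
      refine IsBigO.of_bound (2 ^ (k + 1)) (Eventually.of_forall fun n => ?_)
      rw [Real.norm_of_nonneg (by positivity), norm_one, mul_one]
      exact pow_div_ascFactorial_le (by omega) (Nat.succ_pos _) _
    have h2 := superpolynomialDecay_mul_bounded hpow
      (((isBigO_one_pow hp (k + 1)).mul hd).congr_right fun _ => mul_one 1)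
    exact h2.congr fun n => by ring
  -- The only contribution bounded merely by `ξ^(-K)`; all other errors are superpolynomially small.
  have htail : (fun n : ℕ => (K.factorial : ℝ) * (relScale α n ^ K * ((α n : ℝ) ^ K *
      (∑ j ∈ Finset.Ioc (α n / 2) (α n), saddle α n 1 ^ j *
        ((j.ascFactorial (K + 1) : ℕ) : ℝ)⁻¹) / ((n : ℝ) / α n)))) =O[atTop]
      fun n => (1 / xi ((n : ℝ) / α n)) ^ K := by
    refine IsBigO.const_mul_left ?_ _
    have hb : (fun n : ℕ => (α n : ℝ) ^ K *
        (∑ j ∈ Finset.Ioc (α n / 2) (α n), saddle α n 1 ^ j *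
          ((j.ascFactorial (K + 1) : ℕ) : ℝ)⁻¹) / ((n : ℝ) / α n)) =O[atTop]
        fun _ => (1 : ℝ) := by
      refine IsBigO.of_bound (2 ^ (K + 1)) ?_
      filter_upwards [h.eventually_saddle] with n ⟨hn, ha, hx, hs, _, hu1, _⟩
      have hx0 : 0 < saddle α n 1 := by linarith
      rw [Real.norm_of_nonneg (by positivity), norm_one, mul_one]
      exact pow_mul_sum_div_le hx (by omega) hn hs K
    simpa using (h.relScale_isBigO.pow K).mul hb
  have hsmall := SuperpolynomialDecay.isBigO_inv_pow h.xi_tendsto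
    (SuperpolynomialDecay.add hmain
      (SuperpolynomialDecay.add hhead (SuperpolynomialDecay.const_mul hbdry (-1)))) K
  refine (hsmall.add htail).congr' ?_ EventuallyEq.rfl
  filter_upwards [h.eventually_saddle] with n ⟨hn, ha, hx, hs, _, _, _⟩
  rw [mean, sum_pow_div_ratio_eq hx (by omega) hn hs K (p := relScale α n) rfl rfl]
  simp only [Pi.add_apply, mul_zero, Finset.sum_const_zero, sub_zero]
  ring

theorem mean_sub_var_isBigO (h : Admissible α) (K : ℕ) :
    (fun n : ℕ => (mean α n - var α n) / ((n : ℝ) / α n) -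
      ∑ k ∈ Finset.range K, (1 / xi ((n : ℝ) / α n)) ^ k) =O[atTop]
      fun n => (1 / xi ((n : ℝ) / α n)) ^ K := by
  -- The exact value of `u/(m - v)`, obtained from `var_eq` and `sum_mul_pow_eq`.
  let D : ℕ → ℝ := fun n =>
    1 - relScale α n + 1 / (α n : ℝ) + relScale α n * (1 / ((n : ℝ) / α n))
  have hD : SuperpolyEq atTop (fun n : ℕ => xi ((n : ℝ) / α n)) D
      fun n => 1 - 1 / xi ((n : ℝ) / α n) :=
    (SuperpolynomialDecay.add (SuperpolynomialDecay.const_mul h.relScale_eq (-1))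
      (SuperpolynomialDecay.add h.length h.relScale_mul_eq)).congr fun n => by
        simp only [D, Pi.add_apply]
        ring
  have bound : ∀ {f : ℕ → ℝ}, (∀ᶠ n in atTop, 1 / 2 ≤ f n) →
      (∀ᶠ n in atTop, f n ≠ 0) ∧ (fun n => (f n)⁻¹) =O[atTop] fun _ => (1 : ℝ) := by
    refine fun {f} hf => ⟨hf.mono fun n hn => by linarith,
      IsBigO.of_bound 2 (hf.mono fun n hn => ?_)⟩
    rw [Real.norm_of_nonneg (inv_nonneg.2 (by linarith)), norm_one, mul_one,
      inv_le_comm₀ (by linarith) two_pos]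
    linarith
  have hDge : ∀ᶠ n in atTop, 1 / 2 ≤ D n := by
    filter_upwards [h.relScale_mem, h.eventually_saddle] with n ⟨h1, h2⟩ ⟨_, _, _, _, _, hu1, _⟩
    have : 0 ≤ 1 / (α n : ℝ) := by positivity
    have : 0 ≤ relScale α n * (1 / ((n : ℝ) / α n)) := by positivity
    simp only [D]
    linarith
  have hξge : ∀ᶠ n : ℕ in atTop, 1 / 2 ≤ 1 - 1 / xi ((n : ℝ) / α n) := by
    filter_upwards [h.xi_tendsto.eventually_ge_atTop 2] with n hn
    have := one_div_le_one_div_of_le two_pos hn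
    linarith
  have hinv := hD.inv (bound hDge).1 (bound hξge).1 (bound hDge).2 (bound hξge).2
  -- With `q = 1/ξ`, the truncation error `1/(1 - q) - ∑_{k<K} q^k` of the geometric series equals
  -- `q^K/(1 - q)`.
  have hgeom : (fun n : ℕ => (1 / xi ((n : ℝ) / α n)) ^ K * (1 - 1 / xi ((n : ℝ) / α n))⁻¹)
      =O[atTop] fun n => (1 / xi ((n : ℝ) / α n)) ^ K := by
    simpa using (isBigO_refl (fun n : ℕ => (1 / xi ((n : ℝ) / α n)) ^ K) atTop).mul
      (bound hξge).2
  refine ((SuperpolynomialDecay.isBigO_inv_pow h.xi_tendsto hinv K).add hgeom).congr' ?_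
    EventuallyEq.rfl
  filter_upwards [h.eventually_saddle, (bound hξge).1, (bound hDge).1]
    with n ⟨hn, ha, hx, hs, _, _, _⟩ hξ hDn
  have hn' : (0 : ℝ) < n := by exact_mod_cast hn
  have ha' : (0 : ℝ) < α n := by exact_mod_cast (by omega : 0 < α n)
  have e : (mean α n - var α n) / ((n : ℝ) / α n) = (D n)⁻¹ := by
    rw [var_eq hn (by omega), sum_mul_pow_eq hx (by omega) hn hs]
    have : 1 - 1 / (α n * (1 - 1 / saddle α n 1)) + 1 / (α n : ℝ) +
        1 / (α n * (1 - 1 / saddle α n 1)) / (n / α n) = D n := by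
      simp only [D, relScale]
      ring
    rw [this]
    field_simp
    ring
  have hne : 1 / xi ((n : ℝ) / α n) ≠ 1 := fun h1 => hξ (by rw [h1, sub_self])
  have hgs := geom_sum_eq hne K
  rw [e, hgs]
  have h1 : 1 / xi ((n : ℝ) / α n) - 1 ≠ 0 := sub_ne_zero.2 hne
  have h2 : (1 - 1 / xi ((n : ℝ) / α n))⁻¹ = -(1 / xi ((n : ℝ) / α n) - 1)⁻¹ := by
    rw [← inv_neg, neg_sub]
  rw [h2, div_eq_mul_inv]
  ring

theorem mean_expansion (h : Admissible α) :
    IsAsymptoticExpansion atTop (mean α) 0 (fun k => (k.factorial : ℝ))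
      (fun k n => (n : ℝ) / (α n : ℝ) * (1 / xi ((n : ℝ) / (α n : ℝ)) ^ k)) := by
  refine isAsymptoticExpansion_of_isBigO h.xi_tendsto (h.ratio.eventually_ne_atTop 0)
    fun N _ => ?_
  simpa only [← Nat.range_succ_eq_Icc_zero] using h.mean_isBigO (N + 1)

theorem var_expansion (h : Admissible α) :
    IsAsymptoticExpansion atTop (var α) 2 (fun k => (k.factorial : ℝ) - 1)
      (fun k n => (n : ℝ) / (α n : ℝ) * (1 / xi ((n : ℝ) / (α n : ℝ)) ^ k)) := by
  refine isAsymptoticExpansion_of_isBigO h.xi_tendsto (h.ratio.eventually_ne_atTop 0)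
    fun N hN => ((h.mean_isBigO (N + 1)).sub (h.mean_sub_var_isBigO (N + 1))).congr_left
      fun n => ?_
  -- The terms `k = 0, 1` may be added freely, since `0! - 1 = 1! - 1 = 0`.
  have hsum : ∑ k ∈ Finset.Icc 2 N, ((k.factorial : ℝ) - 1) * (1 / xi ((n : ℝ) / α n)) ^ k =
      ∑ k ∈ Finset.range (N + 1), ((k.factorial : ℝ) - 1) * (1 / xi ((n : ℝ) / α n)) ^ k := by
    refine Finset.sum_subset (fun k hk => ?_) fun k hk hk' => ?_
    · have := Finset.mem_Icc.1 hk
      exact Finset.mem_range.2 (by omega)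
    · rw [Finset.mem_range] at hk
      rw [Finset.mem_Icc] at hk'
      have : k = 0 ∨ k = 1 := by omega
      rcases this with rfl | rfl <;> simp
  rw [hsum]
  simp only [sub_mul, one_mul, Finset.sum_sub_distrib]
  ring

theorem var_isLittleO_mean (h : Admissible α) : var α =o[atTop] mean α := by
  have hξ : Tendsto (fun n : ℕ => 1 / xi ((n : ℝ) / α n)) atTop (𝓝 0) := by
    simp only [one_div]
    exact h.xi_tendsto.inv_tendsto_atTop
  have hm1 := (h.mean_isBigO 1).trans_tendsto (by simpa using hξ)
  have hd1 := (h.mean_sub_var_isBigO 1).trans_tendsto (by simpa using hξ)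
  have hm : Tendsto (fun n : ℕ => mean α n / ((n : ℝ) / α n)) atTop (𝓝 1) := by
    simpa using hm1.add_const 1
  have hv : Tendsto (fun n : ℕ => var α n / ((n : ℝ) / α n)) atTop (𝓝 0) := by
    have := hm1.sub hd1
    rw [sub_zero] at this
    refine this.congr fun n => ?_
    simp
    ring
  have hq := hv.div hm one_ne_zero
  rw [zero_div] at hq
  have hmne : ∀ᶠ n in atTop, mean α n ≠ 0 := by
    filter_upwards [hm.eventually_ne one_ne_zero] with n hn h0
    exact hn (by rw [h0, zero_div])
  refine isLittleO_of_tendsto' (hmne.mono fun n hn h0 => absurd h0 hn) (hq.congr' ?_)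
  filter_upwards [h.ratio.eventually_ne_atTop 0] with n hn
  simp only [Pi.div_apply]
  exact div_div_div_cancel_right₀ hn _ _

end Admissible

end Expansion

end CycleRestricted

theorem theorem2 (α : ℕ → ℕ) (α₀ α₁ : ℝ) (hα₀ : α₀ ∈ Set.Ioo (0 : ℝ) 1)
    (hα₁ : α₁ ∈ Set.Ioo (0 : ℝ) 1)
    (hlow : Tendsto (fun n : ℕ => (n : ℝ) ^ (-α₀) * (α n : ℝ)) atTop atTop)
    (hupp : Tendsto (fun n : ℕ => (n : ℝ) ^ (-α₁) * (α n : ℝ)) atTop (𝓝 0)) :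
    CycleRestricted.IsAsymptoticExpansion atTop (CycleRestricted.mean α)
        0 (fun k => (k.factorial : ℝ))
        (fun k n => (n : ℝ) / (α n : ℝ) * (1 / CycleRestricted.xi ((n : ℝ) / (α n : ℝ)) ^ k)) ∧
      CycleRestricted.IsAsymptoticExpansion atTop (CycleRestricted.var α)
        2 (fun k => (k.factorial : ℝ) - 1)
        (fun k n => (n : ℝ) / (α n : ℝ) * (1 / CycleRestricted.xi ((n : ℝ) / (α n : ℝ)) ^ k)) ∧
      CycleRestricted.var α =o[atTop] CycleRestricted.mean α := by
  have h := CycleRestricted.admissible_of_rpow hα₀.1 hα₁.2 hlow hupp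
  exact ⟨h.mean_expansion, h.var_expansion, h.var_isLittleO_mean⟩
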